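/- Let $m\ge 0$ and $I=[0,1]$. Let $\hat I$ be the split interval: the set of two copies $t$ and $t-$ of each $t\in(0,1]$ together with a single point $0$, totally ordered so that $s<t-<t$ whenever $s<t$, with the order topology; $\hat I^m$ carries the product topology and its Baire $\sigma$-algebra (generated by the continuous real functions). Let $D([0,1]^m)$ be the set of functions $f:[0,1]^m\to\mathbb R$ such that at every $t$ the limit of $f(s)$ as $s\to t$, $s\in J_1\times\dots\times J_m$, exists as a real number whenever each $J_i$ is $[t_i,1]$ or $[0,t_i)$ (the latter only if $t_i>0$). Each such $f$ has a unique continuous extension to $\hat I^m$, also denoted $f$, the value at a point of $\hat I^m$ being the corresponding limit; this identifies $D([0,1]^m)$ with $C(\hat I^m)$. Equip $D([0,1]^m)$ with the $\sigma$-algebra generated by the evaluations $f\mapsto f(t)$, $t\in[0,1]^m$. Let $(\Omega,\mathcal F,\mathbb P)$ be a probability space, let $X:\Omega\to D([0,1]^m)=C(\hat I^m)$ be measurable, and write $X(\tau)$ for $\omega\mapsto X(\omega,\tau)$, $\tau\in\hat I^m$. Let $\mu$ be a (finite) signed Baire measure on $\hat I^m$ with variation $|\mu|$. Then $X(\omega,\tau)$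 is measurable in each variable separately, and the following hold. 1. If $|X(\omega,t)|\le C$ for a constant $C<\infty$ and all $\omega\in\Omega$, $t\in[0,1]^m$, then $\omega\mapsto\int_{\hat I^m}X(\omega,\tau)\,d\mu(\tau)$ is a bounded measurable function on $\Omega$, and $\tau\mapsto\mathbb E[X(\tau)]$ is an element of $C(\hat I^m)$, and thus Baire measurable. 2. If $X\ge0$ and $\mu$ is a positive (finite) Baire measure, then $\omega\mapsto\int_{\hat I^m}X(\omega,\tau)\,d\mu(\tau)$ is a measurable function $\Omega\to[0,\infty]$, and $\tau\mapsto\mathbb E[X(\tau)]$ is a Baire measurable function $\hat I^m\to[0,\infty]$. 3. If $\mathbb E|X(t)|\le C$ for a constant $C<\infty$ and all $t\in[0,1]^m$, then $\int_{\hat I^m}X(\tau)\,d\mu(\tau)$ exists almost surely and defines an integrable random variable, and $\tau\mapsto\mathbb E[X(\tau)]$ is a bounded Baire measurable function on $\hat I^m$. 4. If $\mathbb E\int_{\hat I^m}|X(\tau)|\,d|\mu|(\tau)<\infty$ or $\int_{\hat I^m}\mathbb E[|X(\tau)|]\,d|\mu|(\tau)<\infty$, then $\int_{\hat I^m}X(\tau)\,d\mu(\tau)$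 exists almost surely and defines an integrable random variable, and $\mathbb E[X(\tau)]$ exists for $|\mu|$-a.e. $\tau$ and defines a $\mu$-integrable function on $\hat I^m$ (that is, it is $|\mu|$-a.e. equal to a Baire measurable function and is absolutely integrable with respect to $|\mu|$). In all four cases (in case 2 as an identity in $[0,\infty]$, in the others between real numbers, all integrals involved being absolutely convergent), $$\mathbb E\int_{\hat I^m}X(\tau)\,d\mu(\tau)=\int_{\hat I^m}\mathbb E[X(\tau)]\,d\mu(\tau).$$ -/

import Mathlib

open Set Filter Topology MeasureTheory
open scoped NNReal ENNReal

noncomputable section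

/-- The split interval: two copies `t` and `t-` of every point `t ∈ (0,1]`, together with a single
copy of `0`. The pair `(t, true)` stands for `t` and the pair `(t, false)` for `t-`; the order is
lexicographic with `false < true`, so that `s < t- < t` when `s < t`. -/
def SplitInterval : Type :=
  {p : unitInterval ×ₗ Bool // (ofLex p).1 = 0 → (ofLex p).2 = true}

namespace SplitInterval

instance : LinearOrder SplitInterval :=
  inferInstanceAs
    (LinearOrder {p : unitInterval ×ₗ Bool // (ofLex p).1 = 0 → (ofLex p).2 = true})

/-- The split interval carries the order topology. -/
instance : TopologicalSpace SplitInterval := Preorder.topology SplitInterval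

instance : OrderTopology SplitInterval := ⟨rfl⟩

/-- The projection onto `[0,1]`, sending `t` and `t-` to `t`. -/
def base (x : SplitInterval) : unitInterval := (ofLex x.1).1

/-- `true` at the points `t ∈ [0,1]`, and `false` at the points `t-`. -/
def right (x : SplitInterval) : Bool := (ofLex x.1).2

/-- The (discontinuous) inclusion of `[0,1]` in the split interval. -/
def incl (t : unitInterval) : SplitInterval := ⟨toLex (t, true), fun _ => rfl⟩

@[simp] theorem base_incl (t : unitInterval) : (incl t).base = t := rfl

@[simp] theorem right_incl (t : unitInterval) : (incl t).right = true := rfl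

theorem right_of_base_eq_zero (x : SplitInterval) (h : x.base = 0) : x.right = true := x.2 h

theorem base_pos (x : SplitInterval) (h : x.right = false) : 0 < x.base := by
  rcases eq_or_lt_of_le (unitInterval.nonneg' (t := x.base)) with h0 | h0
  · rw [x.right_of_base_eq_zero h0.symm] at h
    cases h
  · exact h0

theorem lt_iff (x y : SplitInterval) :
    x < y ↔ x.base < y.base ∨ x.base = y.base ∧ x.right < y.right :=
  Prod.Lex.lt_iff (x := x.1) (y := y.1)

theorem le_iff (x y : SplitInterval) :
    x ≤ y ↔ x.base < y.base ∨ x.base = y.base ∧ x.right ≤ y.right :=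
  Prod.Lex.le_iff (x := x.1) (y := y.1)

end SplitInterval

/-- The compact cube `Î^m`, with the product topology. -/
abbrev SplitCube (m : ℕ) : Type := Fin m → SplitInterval

/-- The Baire σ-algebra of a topological space: the σ-algebra generated by the continuous
real-valued functions. -/
@[reducible] def baireSigma (K : Type*) [TopologicalSpace K] : MeasurableSpace K :=
  ⨆ f : C(K, ℝ), MeasurableSpace.comap f (borel ℝ)

/-- `Î^m` carries its Baire σ-algebra, so that measures, signed measures and measurable functions
on it are Baire measures, signed Baire measures and Baire measurable functions. -/
instance instMeasurableSpaceSplitCube (m : ℕ) : MeasurableSpace (SplitCube m) :=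
  baireSigma (SplitCube m)

/-- The one-dimensional factor of an octant at `t`: `[t,1]` if `b` is `true`, and `[0,t)` if `b` is
`false`. -/
def octantSide (t : unitInterval) (b : Bool) : Set unitInterval :=
  if b = true then Set.Ici t else Set.Iio t

/-- The octant `J_1 × ⋯ × J_m` at `t`, where `J_i` is `[t_i,1]` or `[0,t_i)` according to `b_i`. -/
def octant {m : ℕ} (t : Fin m → unitInterval) (b : Fin m → Bool) : Set (Fin m → unitInterval) :=
  Set.univ.pi fun i => octantSide (t i) (b i)

/-- The space `D([0,1]^m)`: the functions `f : [0,1]^m → ℝ` such that at every `t` the limit of `f`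
in each of the octants at `t` exists as a real number (a factor `[0,t_i)` is allowed only if
`t_i > 0`). -/
structure SkorokhodSpace (m : ℕ) where
  /-- The underlying function. -/
  toFun : (Fin m → unitInterval) → ℝ
  /-- Existence of the limits in the octants. -/
  exists_limit : ∀ (t : Fin m → unitInterval) (b : Fin m → Bool),
    (∀ i, b i = false → 0 < t i) → ∃ l : ℝ, Tendsto toFun (𝓝[octant t b] t) (𝓝 l)

namespace SkorokhodSpace

variable {m : ℕ}

instance : CoeFun (SkorokhodSpace m) fun _ => (Fin m → unitInterval) → ℝ := ⟨toFun⟩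

/-- `D([0,1]^m)` carries the σ-algebra generated by the point evaluations at `t ∈ [0,1]^m`. -/
instance : MeasurableSpace (SkorokhodSpace m) :=
  ⨆ t : Fin m → unitInterval, MeasurableSpace.comap (fun f : SkorokhodSpace m => f t) (borel ℝ)

/-- The extension of `f ∈ D([0,1]^m)` to a function on `Î^m`: the value at `τ` is the limit of `f`
in the octant that `τ` stands for (`[t_i,1]` where `τ_i = t_i`, and `[0,t_i)` where
`τ_i = t_i-`). -/
def extendFun (f : SkorokhodSpace m) (τ : SplitCube m) : ℝ :=
  limUnder (𝓝[octant (fun i => (τ i).base) fun i => (τ i).right] fun i => (τ i).base) f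

end SkorokhodSpace

namespace SplitInterval

theorem continuous_base : Continuous base := by
  apply Monotone.continuous_of_surjective
  · intro x y h
    rcases (le_iff x y).1 h with h | h
    · exact h.le
    · exact h.1.le
  · exact fun t => ⟨incl t, rfl⟩

theorem comap_incl_nhds (x : SplitInterval) :
    comap incl (𝓝 x) = 𝓝[octantSide x.base x.right] x.base := by
  apply le_antisymm
  · refine le_inf ?_ ?_
    · have h : Tendsto base (𝓝 x) (𝓝 x.base) := continuous_base.tendsto x
      calc comap incl (𝓝 x) ≤ comap incl (comap base (𝓝 x.base)) :=
            comap_mono (tendsto_iff_comap.1 h)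
        _ = 𝓝 x.base := by
            rw [comap_comap]
            exact comap_id
    · rw [le_principal_iff, mem_comap]
      cases hr : x.right
      · refine ⟨Set.Iio (incl x.base), Iio_mem_nhds ?_, ?_⟩
        · rw [lt_iff]
          exact Or.inr ⟨rfl, by simp [hr]⟩
        · intro u hu
          simpa [lt_iff, octantSide] using hu
      · rcases eq_or_lt_of_le (unitInterval.nonneg' (t := x.base)) with h0 | h0
        · refine ⟨Set.univ, univ_mem, ?_⟩
          intro u _
          simp only [octantSide, if_true, Set.mem_Ici, ← h0]
          exact unitInterval.nonneg'
        · let y : SplitInterval := ⟨toLex (x.base, false), fun h => absurd h h0.ne'⟩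
          refine ⟨Set.Ioi y, Ioi_mem_nhds ?_, ?_⟩
          · rw [lt_iff]
            refine Or.inr ⟨rfl, ?_⟩
            rw [hr]
            exact Bool.false_lt_true
          · intro u hu
            have hu' : y < incl u := hu
            simp only [octantSide, if_true, Set.mem_Ici]
            rcases (lt_iff _ _).1 hu' with h | h
            · exact h.le
            · exact h.1.le
  · rw [← tendsto_iff_comap, tendsto_order]
    constructor
    · intro a ha
      rcases (lt_iff _ _).1 ha with h | h
      · filter_upwards [mem_nhdsWithin_of_mem_nhds (Ioi_mem_nhds h)] with u hu
        exact (lt_iff _ _).2 (Or.inl hu)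
      · have hr : x.right = true := by
          revert h
          cases x.right <;> simp
        filter_upwards [self_mem_nhdsWithin] with u hu
        simp only [hr, octantSide, if_true, Set.mem_Ici] at hu
        refine lt_of_lt_of_le ha ((le_iff _ _).2 ?_)
        rcases eq_or_lt_of_le hu with h1 | h1
        · exact Or.inr ⟨h1, by simp [hr]⟩
        · exact Or.inl h1
    · intro a ha
      rcases (lt_iff _ _).1 ha with h | h
      · filter_upwards [mem_nhdsWithin_of_mem_nhds (Iio_mem_nhds h)] with u hu
        exact (lt_iff _ _).2 (Or.inl hu)
      · have hr : x.right = false := by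
          revert h
          cases x.right <;> cases a.right <;> simp
        filter_upwards [self_mem_nhdsWithin] with u hu
        simp only [hr, octantSide, Bool.false_eq_true, if_false, Set.mem_Iio] at hu
        exact (lt_iff _ _).2 (Or.inl (h.1 ▸ hu))

theorem nhdsWithin_neBot (x : SplitInterval) :
    (𝓝[octantSide x.base x.right] x.base).NeBot := by
  cases hr : x.right
  · simp only [octantSide, Bool.false_eq_true, if_false]
    exact nhdsLT_neBot_of_exists_lt ⟨0, x.base_pos hr⟩
  · simp only [octantSide, if_true]
    exact nhdsWithin_Ici_neBot le_rfl

end SplitInterval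

namespace SplitCube

variable {m : ℕ}

/-- The inclusion of `[0,1]^m` in `Î^m`. -/
def incl (t : Fin m → unitInterval) : SplitCube m := fun i => SplitInterval.incl (t i)

theorem comap_incl_nhds (τ : SplitCube m) :
    comap incl (𝓝 τ) =
      𝓝[octant (fun i => (τ i).base) fun i => (τ i).right] fun i => (τ i).base := by
  rw [octant, nhdsWithin_pi_univ_eq, nhds_pi, Filter.pi, comap_iInf]
  refine iInf_congr fun i => ?_
  rw [← SplitInterval.comap_incl_nhds, comap_comap, comap_comap]
  rfl

theorem nhdsWithin_neBot (τ : SplitCube m) :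
    (𝓝[octant (fun i => (τ i).base) fun i => (τ i).right] fun i => (τ i).base).NeBot :=
  nhdsWithin_pi_neBot.2 fun i _ => SplitInterval.nhdsWithin_neBot (τ i)

theorem denseRange_incl : DenseRange (incl : (Fin m → unitInterval) → SplitCube m) := by
  intro τ
  rw [mem_closure_iff_nhds]
  intro s hs
  have h := nhdsWithin_neBot τ
  rw [← comap_incl_nhds] at h
  obtain ⟨t, ht⟩ := comap_neBot_iff.1 h s hs
  exact ⟨incl t, ht, t, rfl⟩

end SplitCube

namespace SkorokhodSpace

variable {m : ℕ}

theorem tendsto_extendFun (f : SkorokhodSpace m) (τ : SplitCube m) :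
    Tendsto f (comap SplitCube.incl (𝓝 τ)) (𝓝 (f.extendFun τ)) := by
  rw [SplitCube.comap_incl_nhds]
  exact tendsto_nhds_limUnder (f.exists_limit _ _ fun i hi => (τ i).base_pos hi)

theorem continuous_extendFun (f : SkorokhodSpace m) : Continuous f.extendFun := by
  let _ : TopologicalSpace (Fin m → unitInterval) :=
    TopologicalSpace.induced SplitCube.incl inferInstance
  have di : IsDenseInducing (SplitCube.incl : (Fin m → unitInterval) → SplitCube m) :=
    ⟨⟨rfl⟩, SplitCube.denseRange_incl⟩
  have h : di.extend f = f.extendFun :=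
    funext fun τ => di.extend_eq_of_tendsto (f.tendsto_extendFun τ)
  rw [← h]
  exact di.continuous_extend fun τ => ⟨_, f.tendsto_extendFun τ⟩

/-- The identification of `D([0,1]^m)` with `C(Î^m)`, sending `f` to its continuous extension. -/
def extend (f : SkorokhodSpace m) : C(SplitCube m, ℝ) := ⟨f.extendFun, f.continuous_extendFun⟩

/-- The extension restricts to `f` on `[0,1]^m`. -/
theorem extend_incl (f : SkorokhodSpace m) (t : Fin m → unitInterval) :
    f.extend (SplitCube.incl t) = f t := by
  have hp : (pure t : Filter (Fin m → unitInterval)) ≤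
      comap SplitCube.incl (𝓝 (SplitCube.incl t)) := by
    intro s hs
    obtain ⟨u, hu, hus⟩ := mem_comap.1 hs
    exact hus (show SplitCube.incl t ∈ u from mem_of_mem_nhds hu)
  exact tendsto_nhds_unique ((f.tendsto_extendFun (SplitCube.incl t)).mono_left hp)
    (tendsto_pure_nhds f.toFun t)

/-- The restriction to `[0,1]^m` of a continuous function on `Î^m`. -/
def restrict (g : C(SplitCube m, ℝ)) : SkorokhodSpace m where
  toFun t := g (SplitCube.incl t)
  exists_limit t b hb := by
    let τ : SplitCube m := fun i => ⟨toLex (t i, b i), fun h => by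
      by_contra hn
      exact (hb i (by simpa using hn)).ne' h⟩
    have h := (g.continuous.tendsto τ).comp (tendsto_comap (f := SplitCube.incl))
    rw [SplitCube.comap_incl_nhds] at h
    exact ⟨g τ, h⟩

/-- Extension and restriction are mutually inverse bijections `D([0,1]^m) ≃ C(Î^m)`. -/
def equivContinuousMap : SkorokhodSpace m ≃ C(SplitCube m, ℝ) where
  toFun := extend
  invFun := restrict
  left_inv f := by
    have h : (restrict f.extend).toFun = f.toFun := funext f.extend_incl
    cases f
    exact (SkorokhodSpace.mk.injEq ..).symm ▸ h
  right_inv g := by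
    apply DFunLike.coe_injective
    exact SplitCube.denseRange_incl.equalizer (restrict g).extend.continuous g.continuous
      (funext fun t => (restrict g).extend_incl t)

end SkorokhodSpace

end

/-!
# Fubini's theorem for random elements of `D([0,1]^m)`

The difficulty is that `(ω, τ) ↦ X(ω, τ)` need not be jointly measurable on `Ω × Î^m`, so that the
classical theorem of Fubini does not apply to `X` itself. It applies to a modification of `X`.

A continuous function on the compact space `Î^m` jumps by more than `ε` across only finitely many
hyperplanes orthogonal to a given axis (`SplitCube.finite_setOf_jump`), so it takes equal values at
a point with coordinate `t-` and at the one with `t` instead, for all but countably many `t`. For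
each coordinate `i` let `A i` consist of the `t` such that the hyperplane over `t` has positive
measure, or carries a jump of `X` with positive probability. The first kind of `t` is countable
since the measure is finite; the second is countable because otherwise, with positive probability,
infinitely many jumps would exceed some `ε` (`SplitCube.countable_setOf_not_ae_eq_update`).

Let `merge A` move `t-` to `t` in coordinate `i` unless `t ∈ A i`, and put
`Y(ω, τ) = X(ω, merge A τ)`. Then `Y` is jointly measurable, being the limit of functions which
depend on `τ` through countably many values only (`SplitCube.measurable_uncurry_merge`). For every
`ω` it agrees with `X` at almost every `τ`, and for every `τ` it agrees with `X` at almost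
every `ω` (`SplitCube.exists_measurable_modification`). Hence all the integrals of `X` in the
theorem are integrals of `Y`. The theorems of Tonelli and Fubini for `Y`, the latter applied to the
two parts of the Jordan decomposition of the signed measure, give the identities
(`MeasureTheory.SignedMeasure.integral_integral_swap_of_modification`); the bound for the first
moments passes from `[0,1]^m` to `Î^m` by Fatou's lemma.
-/

open Set Filter Topology MeasureTheory
open scoped NNReal ENNReal

/-! ### Topology of the split interval and of the split cube -/

namespace SplitInterval

/-- The half-line of the split interval on which a point has its neighbourhoods: `[t, ∞)` for the
point `t` and `(-∞, t-]` for the point `t-`. It is clopen. -/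
def side (x : SplitInterval) : Set SplitInterval := if x.right = true then Ici x else Iic x

theorem mem_side_self (x : SplitInterval) : x ∈ x.side := by
  unfold side
  split_ifs <;> simp

theorem ext_iff_base_right {x y : SplitInterval} :
    x = y ↔ x.base = y.base ∧ x.right = y.right := by
  refine ⟨fun h => h ▸ ⟨rfl, rfl⟩, fun h => le_antisymm ?_ ?_⟩
  · exact (le_iff x y).2 (Or.inr ⟨h.1, h.2.le⟩)
  · exact (le_iff y x).2 (Or.inr ⟨h.1.symm, h.2.ge⟩)

theorem isClopen_side (x : SplitInterval) : IsClopen x.side := by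
  unfold side
  cases hr : x.right
  · simp only [Bool.false_eq_true, if_false]
    refine ⟨isClosed_Iic, ?_⟩
    have : Iic x = Iio (incl x.base) := by
      ext y
      simp only [mem_Iic, mem_Iio, le_iff, lt_iff, base_incl, right_incl, hr]
      cases y.right <;> simp
    rw [this]
    exact isOpen_Iio
  · simp only [if_true]
    refine ⟨isClosed_Ici, ?_⟩
    rcases eq_or_lt_of_le (unitInterval.nonneg' (t := x.base)) with h0 | h0
    · have : Ici x = univ := by
        refine eq_univ_of_forall fun y => (le_iff _ _).2 ?_
        rcases eq_or_lt_of_le (unitInterval.nonneg' (t := y.base)) with h1 | h1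
        · exact Or.inr ⟨h0.symm.trans h1, by rw [y.right_of_base_eq_zero h1.symm]; simp⟩
        · exact Or.inl (h0 ▸ h1)
      rw [this]
      exact isOpen_univ
    · let z : SplitInterval := ⟨toLex (x.base, false), fun h => absurd h h0.ne'⟩
      have hz : z.base = x.base ∧ z.right = false := ⟨rfl, rfl⟩
      have : Ici x = Ioi z := by
        ext y
        simp only [mem_Ici, mem_Ioi, le_iff, lt_iff, hz, hr]
        cases y.right <;> simp
      rw [this]
      exact isOpen_Ioi

theorem nhds_eq (x : SplitInterval) : 𝓝 x = comap base (𝓝 x.base) ⊓ 𝓟 x.side := by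
  apply le_antisymm
  · refine le_inf (continuous_base.tendsto x).le_comap ?_
    exact le_principal_iff.2 (x.isClopen_side.isOpen.mem_nhds x.mem_side_self)
  · have hb : Tendsto base (comap base (𝓝 x.base) ⊓ 𝓟 x.side) (𝓝 x.base) :=
      tendsto_comap.mono_left inf_le_left
    have hs : ∀ᶠ y in comap base (𝓝 x.base) ⊓ 𝓟 x.side, y ∈ x.side :=
      mem_inf_of_right (mem_principal_self _)
    refine tendsto_id'.1 (tendsto_order.2 ?_)
    unfold side at hs
    constructor
    · intro a ha
      cases hr : x.right
      · rcases (lt_iff _ _).1 ha with h | h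
        · filter_upwards [hb.eventually_const_lt h] with y hy
          exact (lt_iff _ _).2 (Or.inl hy)
        · exact absurd (hr ▸ h.2) (by cases a.right <;> decide)
      · filter_upwards [hs] with y hy
        rw [if_pos hr] at hy
        exact ha.trans_le hy
    · intro a ha
      cases hr : x.right
      · filter_upwards [hs] with y hy
        rw [if_neg (by simp [hr])] at hy
        exact lt_of_le_of_lt hy ha
      · rcases (lt_iff _ _).1 ha with h | h
        · filter_upwards [hb.eventually_lt_const h] with y hy
          exact (lt_iff _ _).2 (Or.inl hy)
        · exact absurd (hr ▸ h.2) (by cases a.right <;> decide)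

theorem tendsto_nhds_iff {α : Type*} {l : Filter α} {u : α → SplitInterval} {x : SplitInterval} :
    Tendsto u l (𝓝 x) ↔
      Tendsto (fun a => (u a).base) l (𝓝 x.base) ∧ ∀ᶠ a in l, u a ∈ x.side := by
  rw [nhds_eq, tendsto_inf, tendsto_comap_iff, tendsto_principal]
  rfl

instance : FirstCountableTopology SplitInterval :=
  ⟨fun x => by rw [nhds_eq]; infer_instance⟩

instance : CompactSpace SplitInterval := by
  refine ⟨isCompact_iff_ultrafilter_le_nhds.2 fun U _ => ?_⟩
  obtain ⟨t, -, ht⟩ := isCompact_iff_ultrafilter_le_nhds.1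
    (isCompact_univ (X := unitInterval)) (U.map base) (by simp)
  have ht' : Tendsto base U (𝓝 t) := ht
  -- The limit is `t` or `t-`, according to the side of `t` that the ultrafilter charges.
  rcases U.em (fun x => incl t ≤ x) with h | h
  · refine ⟨incl t, mem_univ _, tendsto_nhds_iff.2 ⟨ht', ?_⟩⟩
    filter_upwards [h] with x hx using by simpa [side] using hx
  · have h0 : 0 < t := by
      obtain ⟨x, hx⟩ := h.exists
      have hx' := not_le.1 hx
      rcases (lt_iff _ _).1 hx' with h1 | h1
      · exact lt_of_le_of_lt unitInterval.nonneg' h1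
      · have hr : x.right = false := by
          have h2 : x.right < true := h1.2
          revert h2
          cases x.right <;> simp
        exact (x.base_pos hr).trans_eq h1.1
    let z : SplitInterval := ⟨toLex (t, false), fun h => absurd h h0.ne'⟩
    have hz : z.base = t ∧ z.right = false := ⟨rfl, rfl⟩
    refine ⟨z, mem_univ _, tendsto_nhds_iff.2 ⟨ht', ?_⟩⟩
    filter_upwards [h] with x hx
    have hx' := not_le.1 hx
    simp only [side, hz, Bool.false_eq_true, if_false, mem_Iic]
    rw [lt_iff, base_incl, right_incl] at hx'
    rw [le_iff, hz.1, hz.2]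
    rcases hx' with h1 | h1
    · exact Or.inl h1
    · exact Or.inr ⟨h1.1, by cases hr : x.right <;> simp_all⟩

/-- A point of `x.side` over another base point than `x.base` can be moved to the right-hand copy
of its base point without leaving `x.side`. -/
theorem incl_base_mem_side {x y : SplitInterval} (h : y ∈ x.side) (hne : y.base ≠ x.base) :
    incl y.base ∈ x.side := by
  unfold side at h ⊢
  split_ifs at h ⊢
  · exact (le_iff _ _).2 (Or.inl (((le_iff _ _).1 h).elim id fun h => absurd h.1.symm hne))
  · exact (le_iff _ _).2 (Or.inl (((le_iff _ _).1 h).elim id fun h => absurd h.1 hne))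

end SplitInterval

namespace SplitCube

variable {m : ℕ}

/-- Every point of the split cube is the limit of a sequence from `[0,1]^m`. -/
theorem exists_seq_tendsto (τ : SplitCube m) :
    ∃ u : ℕ → Fin m → unitInterval, Tendsto (fun n => incl (u n)) atTop (𝓝 τ) := by
  obtain ⟨v, hv, hlim⟩ := mem_closure_iff_seq_limit.1 (denseRange_incl τ)
  choose u hu using hv
  exact ⟨u, by simpa only [hu] using hlim⟩

/-- A continuous function on the split cube jumps by more than `ε` across only finitely many
hyperplanes orthogonal to a given axis. At a limit point of the places of such jumps, both sides
of the jump would converge to the same point of the cube. -/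
theorem finite_setOf_jump (f : C(SplitCube m, ℝ)) (i : Fin m) {ε : ℝ} (hε : 0 < ε) :
    {t : unitInterval | ∃ τ : SplitCube m, (τ i).base = t ∧
      ε < |f τ - f (Function.update τ i (SplitInterval.incl t))|}.Finite := by
  set S := {t : unitInterval | ∃ τ : SplitCube m, (τ i).base = t ∧
      ε < |f τ - f (Function.update τ i (SplitInterval.incl t))|} with hS
  by_contra hfin
  have hinf : S.Infinite := hfin
  have hne : (cofinite ⊓ 𝓟 S).NeBot := cofinite_inf_principal_neBot_iff.2 hinf
  let U : Ultrafilter unitInterval := Ultrafilter.of (cofinite ⊓ 𝓟 S)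
  have hU : (U : Filter unitInterval) ≤ cofinite ⊓ 𝓟 S := Ultrafilter.of_le _
  have hUS : ∀ᶠ t in (U : Filter unitInterval), t ∈ S :=
    hU (mem_inf_of_right (mem_principal_self S))
  have hex : ∀ t, ∃ τ : SplitCube m, t ∈ S → (τ i).base = t ∧
      ε < |f τ - f (Function.update τ i (SplitInterval.incl t))| := by
    intro t
    by_cases ht : t ∈ S
    · obtain ⟨τ, hτ⟩ := ht
      exact ⟨τ, fun _ => hτ⟩
    · exact ⟨fun _ => SplitInterval.incl 0, fun h => absurd h ht⟩
  choose τ hτ using hex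
  obtain ⟨σ, -, hσ⟩ := isCompact_iff_ultrafilter_le_nhds.1
    (isCompact_univ (X := SplitCube m)) (U.map τ) (by simp)
  have hσ' : Tendsto τ U (𝓝 σ) := hσ
  have hσi := SplitInterval.tendsto_nhds_iff.1 (tendsto_pi_nhds.1 hσ' i)
  have hne' : ∀ᶠ t in (U : Filter unitInterval), t ≠ (σ i).base :=
    hU (mem_inf_of_left (by simp [mem_cofinite]))
  have hincl : Tendsto SplitInterval.incl U (𝓝 (σ i)) := by
    refine SplitInterval.tendsto_nhds_iff.2 ⟨hσi.1.congr' ?_, ?_⟩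
    · filter_upwards [hUS] with t ht
      exact (hτ t ht).1
    · filter_upwards [hUS, hne', hσi.2] with t ht hn hs
      have hb := (hτ t ht).1
      have := SplitInterval.incl_base_mem_side hs (by rwa [hb])
      rwa [hb] at this
  have hupd : Tendsto (fun t => Function.update (τ t) i (SplitInterval.incl t)) U (𝓝 σ) := by
    have := hσ'.update i hincl
    rwa [Function.update_eq_self] at this
  have hdiff := (((f.continuous.tendsto σ).comp hσ').sub ((f.continuous.tendsto σ).comp hupd)).abs
  rw [sub_self, abs_zero] at hdiff
  obtain ⟨t, ht, ht'⟩ := (hUS.and (hdiff.eventually_lt_const hε)).exists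
  exact lt_asymm ht' (hτ t ht).2

theorem countable_setOf_jump (f : C(SplitCube m, ℝ)) (i : Fin m) :
    {t : unitInterval | ∃ τ : SplitCube m, (τ i).base = t ∧
      f τ ≠ f (Function.update τ i (SplitInterval.incl t))}.Countable := by
  refine (countable_iUnion fun n : ℕ => (finite_setOf_jump f i
    (Nat.one_div_pos_of_nat (α := ℝ) (n := n))).countable).mono ?_
  rintro t ⟨τ, hτ, hne⟩
  obtain ⟨n, hn⟩ := exists_nat_one_div_lt (abs_pos.2 (sub_ne_zero.2 hne))
  exact mem_iUnion.2 ⟨n, τ, hτ, hn⟩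

end SplitCube

/-! ### Baire measurability on the split cube -/

theorem Continuous.measurable_baireSigma {K : Type*} [TopologicalSpace K] {f : K → ℝ}
    (hf : Continuous f) : Measurable[baireSigma K] f :=
  measurable_iff_comap_le.2
    (le_iSup (fun g : C(K, ℝ) => MeasurableSpace.comap g (borel ℝ)) ⟨f, hf⟩ |>.trans' (by
      rw [BorelSpace.measurable_eq (α := ℝ)]; rfl))

theorem IsClopen.measurableSet_baireSigma {K : Type*} [TopologicalSpace K] {s : Set K}
    (hs : IsClopen s) : MeasurableSet[baireSigma K] s := by
  have h := (hs.continuous_indicator (f := fun _ => (1 : ℝ))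
    continuous_const).measurable_baireSigma
  have : s = s.indicator (fun _ => (1 : ℝ)) ⁻¹' {1} := by
    ext x
    by_cases hx : x ∈ s <;> simp [hx]
  rw [this]
  exact h (measurableSet_singleton 1)

namespace SplitCube

variable {m : ℕ}

theorem measurable_base (i : Fin m) : Measurable fun τ : SplitCube m => (τ i).base := by
  refine Measurable.subtype_mk (f := fun τ : SplitCube m => ((τ i).base : ℝ)) ?_
  exact (continuous_subtype_val.comp
    (SplitInterval.continuous_base.comp (continuous_apply i))).measurable_baireSigma

theorem measurableSet_apply_eq (i : Fin m) (x : SplitInterval) :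
    MeasurableSet {τ : SplitCube m | τ i = x} := by
  have h1 : MeasurableSet {τ : SplitCube m | (τ i).base = x.base} :=
    measurable_base i (measurableSet_singleton x.base)
  have h2 (y : SplitInterval) : MeasurableSet {τ : SplitCube m | τ i ∈ y.side} :=
    (y.isClopen_side.preimage (continuous_apply i)).measurableSet_baireSigma
  -- The fibre of `base` over the base point of `x` has at most two points, separated by sides.
  have h3 : {τ : SplitCube m | τ i = x} =
      {τ : SplitCube m | (τ i).base = x.base} ∩ {τ : SplitCube m | τ i ∈ x.side} := by
    ext τ
    constructor
    · rintro rfl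
      exact ⟨rfl, SplitInterval.mem_side_self _⟩
    · rintro ⟨hb, hs⟩
      refine SplitInterval.ext_iff_base_right.2 ⟨hb, ?_⟩
      change (τ i).base = x.base at hb
      change τ i ∈ x.side at hs
      unfold SplitInterval.side at hs
      cases hr : x.right
      · have h : (τ i).right ≤ false := by simpa [hr, SplitInterval.le_iff, hb] using hs
        exact le_bot_iff.1 h
      · have h : true ≤ (τ i).right := by simpa [hr, SplitInterval.le_iff, hb] using hs
        exact top_le_iff.1 h
  rw [h3]
  exact h1.inter (h2 x)

end SplitCube

/-! ### Moving points to the right-hand copy outside a countable set -/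

namespace SplitInterval

open scoped Classical in
/-- The map of the split interval that moves `t-` to `t` unless `t ∈ A`. -/
noncomputable def merge (A : Set unitInterval) (x : SplitInterval) : SplitInterval :=
  if x.base ∈ A then x else incl x.base

/-- The least multiple of `1 / (n + 1)` above `t`. -/
noncomputable def ceilGrid (n : ℕ) (t : unitInterval) : unitInterval :=
  ⟨(⌈((n : ℝ) + 1) * t⌉₊ : ℝ) / (n + 1), by positivity, by
    rw [div_le_one (by positivity)]
    have : ⌈((n : ℝ) + 1) * t⌉₊ ≤ n + 1 := by
      rw [Nat.ceil_le]
      push_cast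
      have := t.2.2
      have hn : (0 : ℝ) ≤ (n : ℝ) + 1 := by positivity
      nlinarith
    exact_mod_cast this⟩

theorem le_ceilGrid (n : ℕ) (t : unitInterval) : t ≤ ceilGrid n t := by
  change (t : ℝ) ≤ (⌈((n : ℝ) + 1) * t⌉₊ : ℝ) / (n + 1)
  rw [le_div_iff₀ (by positivity), mul_comm]
  exact Nat.le_ceil _

theorem tendsto_ceilGrid (t : unitInterval) : Tendsto (fun n => ceilGrid n t) atTop (𝓝 t) := by
  rw [tendsto_subtype_rng]
  have hlim : Tendsto (fun n : ℕ => (t : ℝ) + 1 / ((n : ℝ) + 1)) atTop (𝓝 (t : ℝ)) := by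
    simpa using tendsto_const_nhds.add (tendsto_one_div_add_atTop_nhds_zero_nat (𝕜 := ℝ))
  refine tendsto_of_tendsto_of_tendsto_of_le_of_le tendsto_const_nhds hlim
    (fun n => le_ceilGrid n t) fun n => ?_
  change (⌈((n : ℝ) + 1) * t⌉₊ : ℝ) / (n + 1) ≤ (t : ℝ) + 1 / ((n : ℝ) + 1)
  have hn : (0 : ℝ) < (n : ℝ) + 1 := by positivity
  rw [div_le_iff₀ hn, add_mul (t : ℝ), one_div_mul_cancel hn.ne', mul_comm (t : ℝ)]
  exact (Nat.ceil_lt_add_one (mul_nonneg hn.le t.2.1)).le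

theorem measurable_ceilGrid (n : ℕ) : Measurable (ceilGrid n) := by
  refine Measurable.subtype_mk (f := fun t : unitInterval =>
    (⌈((n : ℝ) + 1) * t⌉₊ : ℝ) / (n + 1)) ?_
  fun_prop

theorem countable_range_ceilGrid (n : ℕ) : (range (ceilGrid n)).Countable := by
  have h : range (fun t => (ceilGrid n t : ℝ)) ⊆ range fun k : ℕ => (k : ℝ) / (n + 1) := by
    rintro _ ⟨t, rfl⟩
    exact ⟨⌈((n : ℝ) + 1) * t⌉₊, rfl⟩
  have h' := (countable_range fun k : ℕ => (k : ℝ) / ((n : ℝ) + 1)).mono h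
  rw [show (fun t => (ceilGrid n t : ℝ)) = Subtype.val ∘ ceilGrid n from rfl, range_comp] at h'
  exact countable_of_injective_of_countable_image Subtype.val_injective.injOn h'

open scoped Classical in
/-- Approximations of `merge A` with countable range (when `A` is countable): a point outside `A`
is moved to the right, to a point of the grid of mesh `1 / (n + 1)`. -/
noncomputable def mergeApprox (A : Set unitInterval) (n : ℕ) (x : SplitInterval) : SplitInterval :=
  if x.base ∈ A then x else incl (ceilGrid n x.base)

theorem tendsto_mergeApprox (A : Set unitInterval) (x : SplitInterval) :
    Tendsto (fun n => mergeApprox A n x) atTop (𝓝 (merge A x)) := by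
  unfold mergeApprox merge
  split_ifs
  · exact tendsto_const_nhds
  · refine tendsto_nhds_iff.2 ⟨tendsto_ceilGrid x.base, Eventually.of_forall fun n => ?_⟩
    simp only [side, right_incl, if_true, mem_Ici, le_iff, base_incl]
    rcases (le_ceilGrid n x.base).eq_or_lt with h | h
    · exact Or.inr ⟨h, le_rfl⟩
    · exact Or.inl h

theorem countable_range_mergeApprox {A : Set unitInterval} (hA : A.Countable) (n : ℕ) :
    (range (mergeApprox A n)).Countable := by
  have h1 : {x : SplitInterval | x.base ∈ A}.Countable := by
    refine MapsTo.countable_of_injOn (f := fun x : SplitInterval => (x.base, x.right))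
      (t := A ×ˢ univ) (fun x hx => ⟨hx, mem_univ _⟩) (fun x _ y _ h => ?_)
      (hA.prod (to_countable _))
    exact ext_iff_base_right.2 (Prod.ext_iff.1 h)
  refine (h1.union ((countable_range_ceilGrid n).image incl)).mono ?_
  rintro _ ⟨x, rfl⟩
  unfold mergeApprox
  split_ifs with h
  · exact Or.inl h
  · exact Or.inr ⟨_, ⟨_, rfl⟩, rfl⟩

end SplitInterval

namespace SplitCube

variable {m : ℕ}

/-- The coordinatewise map that moves `t-` to `t` in coordinate `i` unless `t ∈ A i`. -/
noncomputable def merge (A : Fin m → Set unitInterval) (τ : SplitCube m) : SplitCube m :=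
  fun i => (τ i).merge (A i)

theorem measurableSet_mergeApprox_eq {A : Set unitInterval} (hA : A.Countable) (n : ℕ) (i : Fin m)
    (x : SplitInterval) :
    MeasurableSet {τ : SplitCube m | (τ i).mergeApprox A n = x} := by
  have h1 : MeasurableSet {τ : SplitCube m | (τ i).base ∈ A} :=
    measurable_base i hA.measurableSet
  have h2 : MeasurableSet
      {τ : SplitCube m | SplitInterval.incl (SplitInterval.ceilGrid n (τ i).base) = x} := by
    cases hr : x.right
    · convert MeasurableSet.empty
      ext τ
      simp [SplitInterval.ext_iff_base_right, hr]
    · convert ((SplitInterval.measurable_ceilGrid n).comp (measurable_base i))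
        (measurableSet_singleton x.base) using 1
      ext τ
      simp [SplitInterval.ext_iff_base_right, hr]
  convert (h1.inter (measurableSet_apply_eq i x)).union (h1.compl.inter h2) using 1
  ext τ
  by_cases h : (τ i).base ∈ A <;> simp [SplitInterval.mergeApprox, h]

/-- For countable `A i`, composition with `merge A` makes a family of random variables that is
continuous in `τ` jointly measurable: it is the limit of the compositions with `mergeApprox`, which
take countably many values in `τ`. -/
theorem measurable_uncurry_merge {Ω : Type*} [MeasurableSpace Ω] {X : Ω → C(SplitCube m, ℝ)}
    (hX : ∀ τ, Measurable fun ω => X ω τ) {A : Fin m → Set unitInterval}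
    (hA : ∀ i, (A i).Countable) :
    Measurable (Function.uncurry fun ω τ => X ω (merge A τ)) := by
  let Φ : ℕ → SplitCube m → SplitCube m := fun n τ i => (τ i).mergeApprox (A i) n
  have hlim : ∀ τ, Tendsto (fun n => Φ n τ) atTop (𝓝 (merge A τ)) := fun τ =>
    tendsto_pi_nhds.2 fun i => SplitInterval.tendsto_mergeApprox (A i) (τ i)
  refine measurable_of_tendsto_metrizable (f := fun n (p : Ω × SplitCube m) => X p.1 (Φ n p.2))
    (fun n => ?_) (tendsto_pi_nhds.2 fun p => ((X p.1).continuous.tendsto _).comp (hlim p.2))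
  have hcount : (range (Φ n)).Countable := by
    refine (countable_univ_pi fun i =>
      SplitInterval.countable_range_mergeApprox (hA i) n).mono ?_
    rintro _ ⟨τ, rfl⟩ i -
    exact ⟨τ i, rfl⟩
  have : Countable (range (Φ n)) := hcount.to_subtype
  let _ : MeasurableSpace (range (Φ n)) := ⊤
  have hΦ : Measurable (rangeFactorization (Φ n)) := by
    refine measurable_to_countable' fun σ => ?_
    have : rangeFactorization (Φ n) ⁻¹' {σ} =
        ⋂ i, {τ : SplitCube m | (τ i).mergeApprox (A i) n = σ.1 i} := by
      ext τ
      simp only [mem_preimage, mem_singleton_iff, Subtype.ext_iff, mem_iInter, mem_ofPred_eq]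
      exact funext_iff
    rw [this]
    exact MeasurableSet.iInter fun i => measurableSet_mergeApprox_eq (hA i) n i _
  have hXr : Measurable fun p : Ω × range (Φ n) => X p.1 p.2.1 :=
    measurable_from_prod_countable_left fun σ => hX σ.1
  exact hXr.comp (measurable_fst.prodMk (hΦ.comp measurable_snd))

/-- A reflexive and transitive relation holds between `τ` and `merge A τ` if it holds for every move
in a single coordinate: `merge A` is a composition of such moves. -/
theorem rel_merge {A : Fin m → Set unitInterval} {R : SplitCube m → SplitCube m → Prop}
    [Std.Refl R] [IsTrans (SplitCube m) R] {τ : SplitCube m}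
    (h : ∀ i, (τ i).base ∉ A i → ∀ σ : SplitCube m, (σ i).base = (τ i).base →
      R σ (Function.update σ i (SplitInterval.incl (τ i).base))) :
    R τ (merge A τ) := by
  classical
  have key : ∀ S : Finset (Fin m), R τ fun i => if i ∈ S then (τ i).merge (A i) else τ i := by
    intro S
    induction S using Finset.induction_on with
    | empty => simpa using refl_of R τ
    | insert i S hi ih =>
      refine trans_of R ih ?_
      have hupd : (fun j => if j ∈ insert i S then (τ j).merge (A j) else τ j) =
          Function.update (fun j => if j ∈ S then (τ j).merge (A j) else τ j) i
            ((τ i).merge (A i)) := by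
        ext j
        by_cases hj : j = i
        · subst hj
          simp
        · simp [hj]
      rw [hupd]
      by_cases hA : (τ i).base ∈ A i
      · rw [SplitInterval.merge, if_pos hA, Function.update_eq_self_iff.2 (by simp [hi])]
        exact refl_of R _
      · rw [SplitInterval.merge, if_neg hA]
        exact h i hA _ (by simp [hi])
  simpa [merge] using! key Finset.univ

end SplitCube

/-! ### A jointly measurable modification -/

namespace MeasureTheory

/-- If every point of a finite measure space lies in finitely many members of a family of
measurable sets, then countably many members have positive measure. Infinitely many members of
measure at least `δ > 0` would have a point in infinitely many of them. -/
theorem countable_setOf_measure_pos_of_finite {Ω ι : Type*} [MeasurableSpace Ω] {P : Measure Ω}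
    [IsFiniteMeasure P] {E : ι → Set Ω} (hE : ∀ t, MeasurableSet (E t))
    (hfin : ∀ ω, {t | ω ∈ E t}.Finite) : {t | 0 < P (E t)}.Countable := by
  have key : ∀ δ : ℝ≥0∞, 0 < δ → {t | δ < P (E t)}.Finite := by
    intro δ hδ
    by_contra hinf
    let u := Set.Infinite.natEmbedding _ hinf
    let G : ℕ → Set Ω := fun n => ⋃ k ≥ n, E (u k)
    have hG : ∀ n, MeasurableSet (G n) := fun n =>
      MeasurableSet.iUnion fun k => MeasurableSet.iUnion fun _ => hE _
    have hanti : Antitone G := fun a b hab =>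
      biUnion_subset_biUnion_left fun k hk => le_trans hab hk
    have hlim := tendsto_measure_iInter_atTop (μ := P) (fun n => (hG n).nullMeasurableSet) hanti
      ⟨0, measure_ne_top _ _⟩
    have hle : δ ≤ P (⋂ n, G n) := ge_of_tendsto' hlim fun n =>
      (u n).2.le.trans (measure_mono (subset_biUnion_of_mem (u := fun k => E (u k)) (le_refl n)))
    obtain ⟨ω, hω⟩ := nonempty_of_measure_ne_zero (hδ.trans_le hle).ne'
    obtain ⟨N, hN⟩ := (((hfin ω).preimage
      (f := fun k => (u k : ι)) (Subtype.val_injective.comp u.injective).injOn).bddAbove)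
    obtain ⟨k, hk, hωk⟩ := mem_iUnion₂.1 (mem_iInter.1 hω (N + 1))
    have : k ≤ N := hN hωk
    omega
  refine (countable_iUnion fun n : ℕ =>
    (key ((n : ℝ≥0∞) + 1)⁻¹ (by simp)).countable).mono fun t ht => ?_
  obtain ⟨n, hn⟩ := ENNReal.exists_inv_nat_lt (ne_of_gt ht)
  exact mem_iUnion.2 ⟨n, lt_of_le_of_lt (ENNReal.inv_le_inv.2 le_self_add) hn⟩

end MeasureTheory

namespace SplitCube

variable {m : ℕ} {Ω : Type*} [MeasurableSpace Ω] {P : Measure Ω} [IsFiniteMeasure P]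
  {X : Ω → C(SplitCube m, ℝ)}

/-- A random continuous function has only countably many fixed hyperplanes of discontinuity
orthogonal to a given axis. -/
theorem countable_setOf_not_ae_eq_update (hX : ∀ τ, Measurable fun ω => X ω τ) (i : Fin m) :
    {t : unitInterval | ¬ ∀ τ : SplitCube m, (τ i).base = t →
      (fun ω => X ω τ) =ᵐ[P]
        fun ω => X ω (Function.update τ i (SplitInterval.incl t))}.Countable := by
  have hex : ∀ t : unitInterval, ∃ τ : SplitCube m, (τ i).base = t ∧
      ((¬ ∀ τ : SplitCube m, (τ i).base = t → (fun ω => X ω τ) =ᵐ[P]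
        fun ω => X ω (Function.update τ i (SplitInterval.incl t))) →
      ¬ (fun ω => X ω τ) =ᵐ[P]
        fun ω => X ω (Function.update τ i (SplitInterval.incl t))) := by
    intro t
    by_cases h : ∀ τ : SplitCube m, (τ i).base = t → (fun ω => X ω τ) =ᵐ[P]
        fun ω => X ω (Function.update τ i (SplitInterval.incl t))
    · exact ⟨fun _ => SplitInterval.incl t, rfl, fun h' => absurd h h'⟩
    · obtain ⟨τ, hτ⟩ := not_forall.1 h
      obtain ⟨hb, hne⟩ := Classical.not_imp.1 hτ
      exact ⟨τ, hb, fun _ => hne⟩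
  choose τ hb hτ using hex
  let d : unitInterval → Ω → ℝ := fun t ω =>
    |X ω (τ t) - X ω (Function.update (τ t) i (SplitInterval.incl t))|
  have hd : ∀ t, Measurable (d t) := fun t =>
    ((hX (τ t)).sub (hX (Function.update (τ t) i (SplitInterval.incl t)))).norm
  have hcount (n : ℕ) : {t | 0 < P {ω | 1 / ((n : ℝ) + 1) < d t ω}}.Countable := by
    refine countable_setOf_measure_pos_of_finite
      (fun t => measurableSet_lt measurable_const (hd t)) fun ω => ?_
    exact (finite_setOf_jump (X ω) i (Nat.one_div_pos_of_nat (α := ℝ) (n := n))).subset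
      fun t ht => ⟨τ t, hb t, ht⟩
  refine (countable_iUnion hcount).mono fun t ht => ?_
  by_contra hcon
  refine hτ t ht ?_
  have hzero : ∀ n : ℕ, ∀ᵐ ω ∂P, d t ω ≤ 1 / ((n : ℝ) + 1) := fun n => by
    have : P {ω | 1 / ((n : ℝ) + 1) < d t ω} = 0 := by
      by_contra hne
      exact hcon (mem_iUnion.2 ⟨n, pos_iff_ne_zero.2 hne⟩)
    rw [ae_iff]
    simpa only [not_le] using this
  filter_upwards [ae_all_iff.2 hzero] with ω hω
  by_contra hne
  obtain ⟨n, hn⟩ := exists_nat_one_div_lt (abs_pos.2 (sub_ne_zero.2 hne))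
  exact absurd (hω n) (not_le.2 hn)

/-- A random continuous function on the split cube, which need not be jointly measurable, agrees
in each variable separately with a jointly measurable function, up to null sets. -/
theorem exists_measurable_modification (hX : ∀ τ, Measurable fun ω => X ω τ)
    (ν : Measure (SplitCube m)) [IsFiniteMeasure ν] :
    ∃ Y : Ω → SplitCube m → ℝ, Measurable (Function.uncurry Y) ∧
      (∀ ω, X ω =ᵐ[ν] Y ω) ∧ ∀ τ, (fun ω => X ω τ) =ᵐ[P] fun ω => Y ω τ := by
  -- `A₁ i`: the fixed discontinuities of `X`; `A₂ i`: the atoms of the image of `ν` under the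
  -- `i`-th base coordinate.
  let A₁ : Fin m → Set unitInterval := fun i =>
    {t | ¬ ∀ τ : SplitCube m, (τ i).base = t →
      (fun ω => X ω τ) =ᵐ[P] fun ω => X ω (Function.update τ i (SplitInterval.incl t))}
  let A₂ : Fin m → Set unitInterval := fun i => {t | 0 < ν {τ | (τ i).base = t}}
  have hA₂ : ∀ i, (A₂ i).Countable := fun i =>
    Measure.countable_meas_level_set_pos (measurable_base i)
  refine ⟨fun ω τ => X ω (merge (fun i => A₁ i ∪ A₂ i) τ), measurable_uncurry_merge hX
    fun i => (countable_setOf_not_ae_eq_update hX i).union (hA₂ i), fun ω => ?_, fun τ => ?_⟩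
  · -- The jumps of `X ω` outside the atoms `A₂` lie on countably many null hyperplanes.
    have hnull : ∀ i, ∀ᵐ τ ∂ν, ¬ ((τ i).base ∉ A₂ i ∧ ∃ σ : SplitCube m,
        (σ i).base = (τ i).base ∧
          X ω σ ≠ X ω (Function.update σ i (SplitInterval.incl (τ i).base))) := by
      intro i
      have hc := countable_setOf_jump (X ω) i
      have : ∀ᵐ τ ∂ν, ∀ t ∈ {t : unitInterval | ∃ τ : SplitCube m, (τ i).base = t ∧
          X ω τ ≠ X ω (Function.update τ i (SplitInterval.incl t))},
          t ∉ A₂ i → (τ i).base ≠ t := by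
        refine (ae_ball_iff hc).2 fun t _ => ?_
        by_cases ht : t ∈ A₂ i
        · exact Eventually.of_forall fun _ h => absurd ht h
        · have h0 : ν {τ | (τ i).base = t} = 0 := by simpa [A₂] using ht
          have : ∀ᵐ τ ∂ν, (τ i).base ≠ t := by
            rw [ae_iff]
            simpa using h0
          filter_upwards [this] with τ h _ using h
      filter_upwards [this] with τ h
      rintro ⟨h1, h2⟩
      exact h _ h2 h1 rfl
    filter_upwards [ae_all_iff.2 hnull] with τ hτ
    let R : SplitCube m → SplitCube m → Prop := fun σ σ' => X ω σ = X ω σ'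
    have : Std.Refl R := ⟨fun _ => rfl⟩
    have : IsTrans _ R := ⟨fun _ _ _ => Eq.trans⟩
    refine rel_merge (R := R) fun i hi σ hσ => ?_
    by_contra hne
    exact hτ i ⟨fun h => hi (Or.inr h), σ, hσ, hne⟩
  · let R : SplitCube m → SplitCube m → Prop := fun σ σ' =>
      (fun ω => X ω σ) =ᵐ[P] fun ω => X ω σ'
    have : Std.Refl R := ⟨fun _ => EventuallyEq.rfl⟩
    have : IsTrans _ R := ⟨fun _ _ _ => EventuallyEq.trans⟩
    refine rel_merge (R := R) fun i hi σ hσ => ?_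
    exact not_not.1 (fun h => hi (Or.inl h)) σ hσ

end SplitCube

/-! ### Fubini's theorem for a probability measure and a signed measure -/

namespace MeasureTheory

/-- Tonelli's theorem for a function `X` which need not be jointly measurable, but has a jointly
measurable modification `Y` in both variables. -/
theorem lintegral_enorm_swap_of_modification {Ω K : Type*} [MeasurableSpace Ω]
    [MeasurableSpace K] {P : Measure Ω} {ν : Measure K} [SFinite P] [SFinite ν] {X Y : Ω → K → ℝ}
    (hY : Measurable (Function.uncurry Y)) (hK : ∀ ω, X ω =ᵐ[ν] Y ω)
    (hΩ : ∀ τ, (fun ω => X ω τ) =ᵐ[P] fun ω => Y ω τ) :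
    ∫⁻ ω, (∫⁻ τ, ‖X ω τ‖ₑ ∂ν) ∂P = ∫⁻ τ, (∫⁻ ω, ‖X ω τ‖ₑ ∂P) ∂ν := by
  have h1 : ∀ ω, ∫⁻ τ, ‖X ω τ‖ₑ ∂ν = ∫⁻ τ, ‖Y ω τ‖ₑ ∂ν := fun ω =>
    lintegral_congr_ae ((hK ω).fun_comp fun x => ‖x‖ₑ)
  have h2 : ∀ τ, ∫⁻ ω, ‖X ω τ‖ₑ ∂P = ∫⁻ ω, ‖Y ω τ‖ₑ ∂P := fun τ =>
    lintegral_congr_ae ((hΩ τ).fun_comp fun x => ‖x‖ₑ)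
  simp only [h1, h2]
  exact lintegral_lintegral_swap hY.enorm.aemeasurable

end MeasureTheory

namespace MeasureTheory.SignedMeasure

variable {Ω K : Type*} [MeasurableSpace Ω] [MeasurableSpace K] {P : Measure Ω}
  {μ : SignedMeasure K}

theorem variation_eq_posPart_add_negPart (μ : SignedMeasure K) :
    μ.variation = μ.toJordanDecomposition.posPart + μ.toJordanDecomposition.negPart :=
  μ.totalVariation_eq_variation.symm

instance isFiniteMeasure_variation (μ : SignedMeasure K) : IsFiniteMeasure μ.variation :=
  μ.totalVariation_eq_variation ▸ inferInstance

theorem posPart_le_variation (μ : SignedMeasure K) :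
    μ.toJordanDecomposition.posPart ≤ μ.variation := by
  rw [variation_eq_posPart_add_negPart]
  exact Measure.le_add_right le_rfl

theorem negPart_le_variation (μ : SignedMeasure K) :
    μ.toJordanDecomposition.negPart ≤ μ.variation := by
  rw [variation_eq_posPart_add_negPart]
  exact Measure.le_add_left le_rfl

theorem integral_eq_integral_posPart_sub_integral_negPart {f : K → ℝ} (hf : μ.Integrable f) :
    ∫ᵛ τ, f τ ∂<•μ =
      ∫ τ, f τ ∂μ.toJordanDecomposition.posPart - ∫ τ, f τ ∂μ.toJordanDecomposition.negPart := by
  conv_lhs => rw [← μ.toSignedMeasure_toJordanDecomposition, JordanDecomposition.toSignedMeasure]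
  rw [VectorMeasure.integral_sub_vectorMeasure, VectorMeasure.integral_toSignedMeasure,
    VectorMeasure.integral_toSignedMeasure]
  · rw [VectorMeasure.Integrable, Measure.variation_toSignedMeasure]
    exact hf.mono_measure μ.posPart_le_variation
  · rw [VectorMeasure.Integrable, Measure.variation_toSignedMeasure]
    exact hf.mono_measure μ.negPart_le_variation

theorem measurable_integral {Y : Ω → K → ℝ} (hY : Measurable (Function.uncurry Y)) :
    Measurable fun ω => ∫ᵛ τ, Y ω τ ∂<•μ := by
  let D : Set Ω := {ω | ∫⁻ τ, ‖Y ω τ‖ₑ ∂μ.variation < ∞}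
  have hset : MeasurableSet D :=
    measurableSet_lt (Measurable.lintegral_prod_right' hY.enorm) measurable_const
  have hiff : ∀ ω, μ.Integrable (Y ω) ↔ ω ∈ D := fun ω =>
    ⟨fun h => h.2, fun h => ⟨(hY.comp measurable_prodMk_left).aestronglyMeasurable, h⟩⟩
  have heq : (fun ω => ∫ᵛ τ, Y ω τ ∂<•μ) =
      D.indicator fun ω =>
        ∫ τ, Y ω τ ∂μ.toJordanDecomposition.posPart -
          ∫ τ, Y ω τ ∂μ.toJordanDecomposition.negPart := by
    ext ω
    by_cases h : μ.Integrable (Y ω)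
    · rw [indicator_of_mem ((hiff ω).1 h)]
      exact integral_eq_integral_posPart_sub_integral_negPart h
    · rw [indicator_of_notMem (mt (hiff ω).2 h)]
      exact VectorMeasure.integral_undef h
  rw [heq]
  refine Measurable.indicator (Measurable.sub ?_ ?_) hset
  · exact (hY.stronglyMeasurable.integral_prod_right'
      (ν := μ.toJordanDecomposition.posPart)).measurable
  · exact (hY.stronglyMeasurable.integral_prod_right'
      (ν := μ.toJordanDecomposition.negPart)).measurable

theorem measurable_integral_of_modification {X Y : Ω → K → ℝ}
    (hY : Measurable (Function.uncurry Y)) (hK : ∀ ω, X ω =ᵐ[μ.variation] Y ω) :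
    Measurable fun ω => ∫ᵛ τ, X ω τ ∂<•μ := by
  have : (fun ω => ∫ᵛ τ, X ω τ ∂<•μ) = fun ω => ∫ᵛ τ, Y ω τ ∂<•μ :=
    funext fun ω => VectorMeasure.integral_congr_ae (hK ω)
  rw [this]
  exact measurable_integral hY

variable [SFinite P]

theorem integrable_integral_prod {Y : Ω → K → ℝ}
    (hY : Integrable (Function.uncurry Y) (P.prod μ.variation)) :
    Integrable (fun ω => ∫ᵛ τ, Y ω τ ∂<•μ) P ∧
      ∫ ω, (∫ᵛ τ, Y ω τ ∂<•μ) ∂P = ∫ᵛ τ, (∫ ω, Y ω τ ∂P) ∂<•μ := by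
  have hp : Integrable (Function.uncurry Y) (P.prod μ.toJordanDecomposition.posPart) :=
    hY.mono_measure (Measure.prod_mono le_rfl μ.posPart_le_variation)
  have hn : Integrable (Function.uncurry Y) (P.prod μ.toJordanDecomposition.negPart) :=
    hY.mono_measure (Measure.prod_mono le_rfl μ.negPart_le_variation)
  have hae : (fun ω => ∫ᵛ τ, Y ω τ ∂<•μ) =ᵐ[P] fun ω =>
      ∫ τ, Y ω τ ∂μ.toJordanDecomposition.posPart -
        ∫ τ, Y ω τ ∂μ.toJordanDecomposition.negPart := by
    filter_upwards [hY.prod_right_ae] with ω hω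
    exact integral_eq_integral_posPart_sub_integral_negPart hω
  have hp' : Integrable (fun ω => ∫ τ, Y ω τ ∂μ.toJordanDecomposition.posPart) P :=
    hp.integral_prod_left
  have hn' : Integrable (fun ω => ∫ τ, Y ω τ ∂μ.toJordanDecomposition.negPart) P :=
    hn.integral_prod_left
  refine ⟨(hp'.sub hn').congr hae.symm, ?_⟩
  rw [integral_congr_ae hae, integral_sub hp' hn',
    integral_integral_swap hp, integral_integral_swap hn,
    integral_eq_integral_posPart_sub_integral_negPart (f := fun τ => ∫ ω, Y ω τ ∂P)
      hY.integral_prod_right]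

/-- Fubini's theorem for a function `X` which need not be jointly measurable, but has a jointly
measurable modification `Y` in both variables. -/
theorem integral_integral_swap_of_modification {X Y : Ω → K → ℝ}
    (hY : Measurable (Function.uncurry Y)) (hK : ∀ ω, X ω =ᵐ[μ.variation] Y ω)
    (hΩ : ∀ τ, (fun ω => X ω τ) =ᵐ[P] fun ω => Y ω τ)
    (hfin : ∫⁻ ω, (∫⁻ τ, ‖X ω τ‖ₑ ∂μ.variation) ∂P < ∞) :
    (∀ᵐ ω ∂P, μ.Integrable (X ω)) ∧
      Integrable (fun ω => ∫ᵛ τ, X ω τ ∂<•μ) P ∧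
      (∀ᵐ τ ∂μ.variation, Integrable (fun ω => X ω τ) P) ∧
      μ.Integrable (fun τ => ∫ ω, X ω τ ∂P) ∧
      ∫ ω, (∫ᵛ τ, X ω τ ∂<•μ) ∂P = ∫ᵛ τ, (∫ ω, X ω τ ∂P) ∂<•μ := by
  have hint : Integrable (Function.uncurry Y) (P.prod μ.variation) := by
    refine ⟨hY.aestronglyMeasurable, ?_⟩
    rw [hasFiniteIntegral_iff_enorm, lintegral_prod _ hY.enorm.aemeasurable]
    refine lt_of_eq_of_lt (lintegral_congr fun ω => lintegral_congr_ae ?_) hfin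
    filter_upwards [hK ω] with τ h
    simp [h]
  have h1 : ∀ ω, ∫ᵛ τ, X ω τ ∂<•μ = ∫ᵛ τ, Y ω τ ∂<•μ := fun ω =>
    VectorMeasure.integral_congr_ae (hK ω)
  have h2 : ∀ τ, ∫ ω, X ω τ ∂P = ∫ ω, Y ω τ ∂P := fun τ => integral_congr_ae (hΩ τ)
  simp only [h1, h2]
  refine ⟨?_, (integrable_integral_prod hint).1, ?_, hint.integral_prod_right,
    (integrable_integral_prod hint).2⟩
  · filter_upwards [hint.prod_right_ae] with ω h
    exact h.congr (hK ω).symm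
  · filter_upwards [hint.prod_left_ae] with τ h
    exact h.congr (hΩ τ).symm

end MeasureTheory.SignedMeasure

/-! ### Random elements of the space `D([0,1]^m)` -/

namespace SkorokhodSpace

variable {m : ℕ} {Ω : Type*} [MeasurableSpace Ω] {P : Measure Ω} {X : Ω → SkorokhodSpace m}

theorem measurable_apply (t : Fin m → unitInterval) :
    Measurable fun f : SkorokhodSpace m => f t :=
  measurable_iff_comap_le.2
    (le_iSup (fun t => MeasurableSpace.comap (fun f : SkorokhodSpace m => f t) (borel ℝ)) t
      |>.trans' (by rw [BorelSpace.measurable_eq (α := ℝ)]))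

theorem tendsto_extend (f : SkorokhodSpace m) {u : ℕ → Fin m → unitInterval} {τ : SplitCube m}
    (hu : Tendsto (fun n => SplitCube.incl (u n)) atTop (𝓝 τ)) :
    Tendsto (fun n => f (u n)) atTop (𝓝 (f.extend τ)) := by
  simpa only [Function.comp_def, extend_incl] using (f.extend.continuous.tendsto τ).comp hu

theorem measurable_extend_apply (hX : Measurable X) (τ : SplitCube m) :
    Measurable fun ω => (X ω).extend τ := by
  obtain ⟨u, hu⟩ := SplitCube.exists_seq_tendsto τ
  exact measurable_of_tendsto_metrizable (f := fun n ω => X ω (u n))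
    (fun n => (measurable_apply (u n)).comp hX)
    (tendsto_pi_nhds.2 fun ω => (X ω).tendsto_extend hu)

theorem extend_mem_of_isClosed (f : SkorokhodSpace m) {S : Set ℝ} (hS : IsClosed S)
    (h : ∀ t, f t ∈ S) (τ : SplitCube m) : f.extend τ ∈ S := by
  obtain ⟨u, hu⟩ := SplitCube.exists_seq_tendsto τ
  exact hS.mem_of_tendsto (f.tendsto_extend hu) (Eventually.of_forall fun n => h (u n))

/-- By Fatou's lemma, a bound for the first absolute moments on `[0,1]^m` extends to the split
cube. -/
theorem lintegral_enorm_extend_le (hX : Measurable X) {C : ℝ≥0∞}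
    (h : ∀ t, ∫⁻ ω, ‖X ω t‖ₑ ∂P ≤ C) (τ : SplitCube m) :
    ∫⁻ ω, ‖(X ω).extend τ‖ₑ ∂P ≤ C := by
  obtain ⟨u, hu⟩ := SplitCube.exists_seq_tendsto τ
  calc ∫⁻ ω, ‖(X ω).extend τ‖ₑ ∂P
      = ∫⁻ ω, liminf (fun n => ‖X ω (u n)‖ₑ) atTop ∂P :=
        lintegral_congr fun ω => (((X ω).tendsto_extend hu).enorm.liminf_eq).symm
    _ ≤ liminf (fun n => ∫⁻ ω, ‖X ω (u n)‖ₑ ∂P) atTop :=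
        lintegral_liminf_le fun n => ((measurable_apply (u n)).comp hX).enorm
    _ ≤ C := by
        refine (liminf_le_liminf (Eventually.of_forall fun n => h (u n))).trans ?_
        simp

end SkorokhodSpace

theorem theorem6p1 (m : ℕ) {Ω : Type*} [MeasurableSpace Ω] (P : Measure Ω)
    [IsProbabilityMeasure P] (X : Ω → SkorokhodSpace m) (hX : Measurable X) :
    -- separate measurability, so that all the integrals below are meaningful
    ((∀ ω, Measurable fun τ => (X ω).extend τ) ∧ ∀ τ, Measurable fun ω => (X ω).extend τ) ∧
    -- bounded `X`
    (∀ (μ : SignedMeasure (SplitCube m)) (C : ℝ), (∀ ω t, |X ω t| ≤ C) →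
      (∀ ω, μ.Integrable fun τ => (X ω).extend τ) ∧
      Measurable (fun ω => ∫ᵛ τ, (X ω).extend τ ∂<•μ) ∧
      (∃ B : ℝ, ∀ ω, |∫ᵛ τ, (X ω).extend τ ∂<•μ| ≤ B) ∧
      (∀ τ, Integrable (fun ω => (X ω).extend τ) P) ∧
      Continuous (fun τ => ∫ ω, (X ω).extend τ ∂P) ∧
      Measurable (fun τ => ∫ ω, (X ω).extend τ ∂P) ∧
      Integrable (fun ω => ∫ᵛ τ, (X ω).extend τ ∂<•μ) P ∧
      μ.Integrable (fun τ => ∫ ω, (X ω).extend τ ∂P) ∧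
      ∫ ω, (∫ᵛ τ, (X ω).extend τ ∂<•μ) ∂P = ∫ᵛ τ, (∫ ω, (X ω).extend τ ∂P) ∂<•μ) ∧
    -- nonnegative `X` and a positive (finite) Baire measure, integrals in `[0, ∞]`
    (∀ (ν : Measure (SplitCube m)) [IsFiniteMeasure ν], (∀ ω t, 0 ≤ X ω t) →
      (∀ ω τ, 0 ≤ (X ω).extend τ) ∧
      Measurable (fun ω => ∫⁻ τ, ENNReal.ofReal ((X ω).extend τ) ∂ν) ∧
      Measurable (fun τ => ∫⁻ ω, ENNReal.ofReal ((X ω).extend τ) ∂P) ∧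
      ∫⁻ ω, (∫⁻ τ, ENNReal.ofReal ((X ω).extend τ) ∂ν) ∂P =
        ∫⁻ τ, (∫⁻ ω, ENNReal.ofReal ((X ω).extend τ) ∂P) ∂ν) ∧
    -- uniformly bounded first absolute moments
    (∀ (μ : SignedMeasure (SplitCube m)) (C : ℝ≥0), (∀ t, ∫⁻ ω, ‖X ω t‖ₑ ∂P ≤ C) →
      (∀ᵐ ω ∂P, μ.Integrable fun τ => (X ω).extend τ) ∧
      Measurable (fun ω => ∫ᵛ τ, (X ω).extend τ ∂<•μ) ∧
      Integrable (fun ω => ∫ᵛ τ, (X ω).extend τ ∂<•μ) P ∧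
      (∀ τ, Integrable (fun ω => (X ω).extend τ) P) ∧
      (∃ B : ℝ, ∀ τ, |∫ ω, (X ω).extend τ ∂P| ≤ B) ∧
      Measurable (fun τ => ∫ ω, (X ω).extend τ ∂P) ∧
      μ.Integrable (fun τ => ∫ ω, (X ω).extend τ ∂P) ∧
      ∫ ω, (∫ᵛ τ, (X ω).extend τ ∂<•μ) ∂P = ∫ᵛ τ, (∫ ω, (X ω).extend τ ∂P) ∂<•μ) ∧
    -- integrability of `|X|` against `|μ|` and `P`, in either order
    (∀ μ : SignedMeasure (SplitCube m),
      (∫⁻ ω, (∫⁻ τ, ‖(X ω).extend τ‖ₑ ∂μ.variation) ∂P < ∞ ∨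
        ∫⁻ τ, (∫⁻ ω, ‖(X ω).extend τ‖ₑ ∂P) ∂μ.variation < ∞) →
      (∀ᵐ ω ∂P, μ.Integrable fun τ => (X ω).extend τ) ∧
      Measurable (fun ω => ∫ᵛ τ, (X ω).extend τ ∂<•μ) ∧
      Integrable (fun ω => ∫ᵛ τ, (X ω).extend τ ∂<•μ) P ∧
      (∀ᵐ τ ∂μ.variation, Integrable (fun ω => (X ω).extend τ) P) ∧
      μ.Integrable (fun τ => ∫ ω, (X ω).extend τ ∂P) ∧
      ∫ ω, (∫ᵛ τ, (X ω).extend τ ∂<•μ) ∂P = ∫ᵛ τ, (∫ ω, (X ω).extend τ ∂P) ∂<•μ) := by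
  have hXm : ∀ τ, Measurable fun ω => (X ω).extend τ :=
    SkorokhodSpace.measurable_extend_apply hX
  have hXc : ∀ ω, Measurable fun τ => (X ω).extend τ := fun ω =>
    (X ω).extend.continuous.measurable_baireSigma
  refine ⟨⟨hXc, hXm⟩, ?_, ?_, ?_, ?_⟩
  · intro μ C hC
    obtain ⟨Y, hY, hK, hΩ⟩ := SplitCube.exists_measurable_modification (P := P) hXm μ.variation
    have hbd : ∀ ω τ, ‖(X ω).extend τ‖ ≤ C := fun ω τ =>
      (X ω).extend_mem_of_isClosed (S := {x | ‖x‖ ≤ C})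
        (isClosed_le continuous_norm continuous_const) (hC ω) τ
    have hintK : ∀ ω, μ.Integrable fun τ => (X ω).extend τ := fun ω =>
      Integrable.of_bound (hXc ω).aestronglyMeasurable C (Eventually.of_forall (hbd ω))
    have hfin : ∫⁻ ω, (∫⁻ τ, ‖(X ω).extend τ‖ₑ ∂μ.variation) ∂P < ∞ := by
      refine (lintegral_mono fun ω => lintegral_mono fun τ =>
        (enorm_le_iff_norm_le.2 ((hbd ω τ).trans (le_abs_self C)) : _ ≤ ‖C‖ₑ)).trans_lt ?_
      simp only [lintegral_const]
      finiteness
    obtain ⟨-, h2, -, h4, h5⟩ :=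
      SignedMeasure.integral_integral_swap_of_modification hY hK hΩ hfin
    have hcont : Continuous fun τ => ∫ ω, (X ω).extend τ ∂P :=
      continuous_of_dominated (bound := fun _ => C) (fun τ => (hXm τ).aestronglyMeasurable)
        (fun τ => Eventually.of_forall fun ω => hbd ω τ) (integrable_const C)
        (Eventually.of_forall fun ω => (X ω).extend.continuous)
    refine ⟨hintK, SignedMeasure.measurable_integral_of_modification hY hK,
      ⟨_, fun ω => VectorMeasure.norm_integral_le_of_norm_le_const (μ := μ)
          (B := (ContinuousLinearMap.lsmul ℝ ℝ).flip)
          (Eventually.of_forall (hbd ω))⟩,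
      fun τ => Integrable.of_bound (hXm τ).aestronglyMeasurable C
        (Eventually.of_forall fun ω => hbd ω τ), hcont, hcont.measurable_baireSigma, h2, h4, h5⟩
  · intro ν _ hpos
    obtain ⟨Y, hY, hK, hΩ⟩ := SplitCube.exists_measurable_modification (P := P) hXm ν
    have hY' : Measurable (Function.uncurry fun ω τ => ENNReal.ofReal (Y ω τ)) :=
      hY.ennreal_ofReal
    have h1 : ∀ ω, ∫⁻ τ, ENNReal.ofReal ((X ω).extend τ) ∂ν = ∫⁻ τ, ENNReal.ofReal (Y ω τ) ∂ν :=
      fun ω => lintegral_congr_ae ((hK ω).fun_comp ENNReal.ofReal)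
    have h2 : ∀ τ, ∫⁻ ω, ENNReal.ofReal ((X ω).extend τ) ∂P = ∫⁻ ω, ENNReal.ofReal (Y ω τ) ∂P :=
      fun τ => lintegral_congr_ae ((hΩ τ).fun_comp ENNReal.ofReal)
    simp only [h1, h2]
    exact ⟨fun ω τ => (X ω).extend_mem_of_isClosed isClosed_Ici (hpos ω) τ,
      hY'.lintegral_prod_right', hY'.lintegral_prod_left',
      lintegral_lintegral_swap hY'.aemeasurable⟩
  · intro μ C hC
    obtain ⟨Y, hY, hK, hΩ⟩ := SplitCube.exists_measurable_modification (P := P) hXm μ.variation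
    have hle : ∀ τ, ∫⁻ ω, ‖(X ω).extend τ‖ₑ ∂P ≤ C :=
      SkorokhodSpace.lintegral_enorm_extend_le hX hC
    have hfin : ∫⁻ ω, (∫⁻ τ, ‖(X ω).extend τ‖ₑ ∂μ.variation) ∂P < ∞ := by
      rw [lintegral_enorm_swap_of_modification hY hK hΩ]
      refine (lintegral_mono hle).trans_lt ?_
      simp only [lintegral_const]
      finiteness
    obtain ⟨h1, h2, -, h4, h5⟩ :=
      SignedMeasure.integral_integral_swap_of_modification hY hK hΩ hfin
    refine ⟨h1, SignedMeasure.measurable_integral_of_modification hY hK, h2,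
      fun τ => ⟨(hXm τ).aestronglyMeasurable, (hle τ).trans_lt (by simp)⟩,
      ⟨C, fun τ => ?_⟩, ?_, h4, h5⟩
    · have := (enorm_integral_le_lintegral_enorm (μ := P) fun ω => (X ω).extend τ).trans (hle τ)
      rw [enorm_le_coe] at this
      exact_mod_cast this
    · rw [funext fun τ => integral_congr_ae (hΩ τ)]
      exact (hY.stronglyMeasurable.integral_prod_left' (μ := P)).measurable
  · intro μ hor
    obtain ⟨Y, hY, hK, hΩ⟩ := SplitCube.exists_measurable_modification (P := P) hXm μ.variation
    have hfin : ∫⁻ ω, (∫⁻ τ, ‖(X ω).extend τ‖ₑ ∂μ.variation) ∂P < ∞ := by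
      refine hor.elim id fun h => ?_
      rwa [lintegral_enorm_swap_of_modification hY hK hΩ]
    obtain ⟨h1, h2, h3, h4, h5⟩ :=
      SignedMeasure.integral_integral_swap_of_modification hY hK hΩ hfin
    exact ⟨h1, SignedMeasure.measurable_integral_of_modification hY hK, h2, h3, h4, h5⟩
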